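/- Let $R$ be an associative ring with identity that is left and right Noetherian, let $A$ be a finitely generated left $R$-module and let $M$ be a finitely generated right $R$-module. A (left or right) $R$-module $G$ is called Gorenstein projective if there is an exact complex $\cdots\to P_1\to P_0\to P^0\to P^1\to\cdots$ of (not necessarily finitely generated) projective modules that stays exact after applying $\operatorname{Hom}_R(-,P)$ for every projective module $P$, and such that $G\cong\operatorname{Im}(P_0\to P^0)$. Write $X^*=\operatorname{Hom}_R(X,R)$. A right $R$-module is a transpose of $A$ if it is isomorphic to $\operatorname{Coker}(f^*\colon P_0^*\to P_1^*)$ for some exact sequence $P_1\xrightarrow{f}P_0\to A\to 0$ with $P_0,P_1$ finitely generated projective left $R$-modules; it is a Gorenstein transpose of $A$ if it is isomorphic to $\operatorname{Coker}(g^*\colon X_0^*\to X_1^*)$ for some exact sequence $X_1\xrightarrow{g}X_0\to A\to 0$ with $X_0,X_1$ finitely generated Gorenstein projective left $R$-modules. Then $M$ is a Gorenstein transpose of $A$ if and only if there is an exact sequence $0\to M\to \operatorname{Tr}A\to H\to 0$ of finitely generated right $R$-modules in which $\operatorname{Tr}A$ is some transpose of $A$ and $H$ is Gorenstein projective. -/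

import Mathlib

universe u v w

/-- `G` is a Gorenstein projective `R`-module: there is an exact complex `(P, d)`, indexed by `ℤ`,
of (not necessarily finitely generated) projective modules which stays exact after applying
`Hom_R(-, Q)` for every projective module `Q`, and `G` is isomorphic to the image of one of its
differentials, namely of `d 0 : P 0 → P 1`.
The right modules over `R` are the modules over `Rᵐᵒᵖ`. -/
def IsGorensteinProjective (R : Type u) [Ring R] (G : Type u) [AddCommGroup G] [Module R G] :
    Prop :=
  ∃ (P : ℤ → Type u) (_ : ∀ i, AddCommGroup (P i)) (_ : ∀ i, Module R (P i))
    (d : ∀ i : ℤ, P i →ₗ[R] P (i + 1)),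
    (∀ i, Module.Projective R (P i)) ∧
    (∀ i, Function.Exact (d i) (d (i + 1))) ∧
    (∀ (Q : Type u) [AddCommGroup Q] [Module R Q], Module.Projective R Q →
      ∀ i, Function.Exact (fun φ : P (i + 1 + 1) →ₗ[R] Q => φ ∘ₗ d (i + 1))
        (fun φ : P (i + 1) →ₗ[R] Q => φ ∘ₗ d i)) ∧
    Nonempty (G ≃ₗ[R] LinearMap.range (d 0))

/-- The right `R`-linear map `f^* : X₀^* → X₁^*`, `φ ↦ φ ∘ f`, induced by a map `f : X₁ → X₀` of
left `R`-modules, where `X^* = Hom_R(X, R)` with its right `R`-module structure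
`(φ · r) x = φ x * r`. -/
def starMap (R : Type u) [Ring R] {X₁ : Type v} {X₀ : Type w}
    [AddCommGroup X₁] [Module R X₁] [AddCommGroup X₀] [Module R X₀] (f : X₁ →ₗ[R] X₀) :
    (X₀ →ₗ[R] R) →ₗ[Rᵐᵒᵖ] (X₁ →ₗ[R] R) where
  toFun φ := φ ∘ₗ f
  map_add' φ ψ := LinearMap.add_comp f ψ φ
  map_smul' r φ := LinearMap.smul_comp r φ f

/-- The right `R`-module `Coker f^*`. -/
abbrev CokerStar (R : Type u) [Ring R] {X₁ : Type v} {X₀ : Type w}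
    [AddCommGroup X₁] [Module R X₁] [AddCommGroup X₀] [Module R X₀] (f : X₁ →ₗ[R] X₀) :=
  (X₁ →ₗ[R] R) ⧸ LinearMap.range (starMap R f)

/-- The right `R`-module `T` is (isomorphic to) a transpose of the left `R`-module `A`: it is
`Coker f^*` for some exact sequence `P₁ → P₀ → A → 0`, with first map `f`, in which `P₁` and `P₀`
are finitely generated projective.  (Every finitely generated module over a ring in `Type u` has
an isomorphic copy in `Type u`, so it is enough to let `P₁` and `P₀` range over that universe.) -/
def IsTranspose (R : Type u) [Ring R] (A : Type v) [AddCommGroup A] [Module R A]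
    (T : Type w) [AddCommGroup T] [Module Rᵐᵒᵖ T] : Prop :=
  ∃ (P₁ P₀ : Type u) (_ : AddCommGroup P₁) (_ : Module R P₁) (_ : AddCommGroup P₀)
    (_ : Module R P₀) (f : P₁ →ₗ[R] P₀) (p : P₀ →ₗ[R] A),
    Module.Finite R P₁ ∧ Module.Finite R P₀ ∧
    Module.Projective R P₁ ∧ Module.Projective R P₀ ∧
    Function.Exact f p ∧ Function.Surjective p ∧
    Nonempty (T ≃ₗ[Rᵐᵒᵖ] CokerStar R f)

/-- The right `R`-module `T` is (isomorphic to) a Gorenstein transpose of the left `R`-module `A`: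
it is `Coker g^*` for some exact sequence `X₁ → X₀ → A → 0`, with first map `g`, in which `X₁` and
`X₀` are finitely generated Gorenstein projective. -/
def IsGorensteinTranspose (R : Type u) [Ring R] (A : Type v) [AddCommGroup A] [Module R A]
    (T : Type w) [AddCommGroup T] [Module Rᵐᵒᵖ T] : Prop :=
  ∃ (X₁ X₀ : Type u) (_ : AddCommGroup X₁) (_ : Module R X₁) (_ : AddCommGroup X₀)
    (_ : Module R X₀) (g : X₁ →ₗ[R] X₀) (p : X₀ →ₗ[R] A),
    Module.Finite R X₁ ∧ Module.Finite R X₀ ∧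
    IsGorensteinProjective R X₁ ∧ IsGorensteinProjective R X₀ ∧
    Function.Exact g p ∧ Function.Surjective p ∧
    Nonempty (T ≃ₗ[Rᵐᵒᵖ] CokerStar R g)

/-!
Write `X^* = Hom_R(X, R)`; finitely generated Gorenstein projective modules `X` satisfy
`Ext¹(X, R) = 0`, so duality is exact on the short exact sequences that end in them.

* Let `M = Coker g^*` for `g : X₁ → X₀` between finitely generated Gorenstein projective modules
  with cokernel `A`. With an epimorphism `P₀ → X₀` from a finitely generated projective module, the
  fibre product `Y = P₀ ×_{X₀} X₁` is Gorenstein projective, being an extension of `X₁` by a syzygy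
  of `X₀`, and passing from `g` to `Y → P₀` changes neither the cokernel `A` nor the module `M`.
  Covering `Y` by a finitely generated projective module `P₁` with kernel `L` gives an exact
  sequence `0 → M → Coker (P₁ → P₀)^* → L^* → 0`, and `H = L^*`.
* Conversely, for `Tr A = Coker f^*` with `f : P₁ → P₀`, let `K` be the kernel of
  `P₁^* → Tr A → H`. It is a syzygy of `H`, so it is Gorenstein projective and reflexive, and
  `P₁ → K^*` is onto because `Ext¹(H, R) = 0`. Hence `f` factors through a map `g : K^* → P₀` with
  the same image, and `Coker g^* = K / Im f^* ≅ M`.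

The argument needs the finitely generated Gorenstein projective modules, defined through complexes
of arbitrary projective modules, to be reflexive and closed under extensions, syzygies and duals.
All of this is derived from one coinduction principle,
`IsGorensteinClass.isGorensteinProjective`: the members of a class that contains syzygies and
cosyzygies of its members, and all of whose members `X` satisfy `Ext¹(X, Q) = 0` for projective
`Q`, are Gorenstein projective. Exhibiting such classes proves closure under
extensions, duals and the removal of projective summands; together with Schanuel's lemma this gives
closure under arbitrary syzygies. Finite generation enters in
`IsGorensteinProjective.exists_finite_cosyzygy`: generators of `X^*`, of which finitely many suffice
since `Rᵐᵒᵖ` is Noetherian, embed `X` in a finitely generated free module, and the cokernel is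
compared with an arbitrary cosyzygy by the dual of Schanuel's lemma, after which the projective
summand is cancelled by `IsGorensteinProjective.of_prod`.
-/

/-! ### Short exact sequences and Schanuel's lemma -/

section ShortExact

variable {R : Type*} [Ring R]

/-- `0 → X → Y → Z → 0` is a short exact sequence. -/
structure IsShortExact {X Y Z : Type*} [AddCommGroup X] [Module R X] [AddCommGroup Y]
    [Module R Y] [AddCommGroup Z] [Module R Z] (i : X →ₗ[R] Y) (p : Y →ₗ[R] Z) : Prop where
  inj : Function.Injective i
  exact : Function.Exact i p
  surj : Function.Surjective p

/-- Every linear map `X → Q` extends along `i : X → Y`. -/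
def Extends {X Y : Type*} [AddCommGroup X] [Module R X] [AddCommGroup Y] [Module R Y]
    (i : X →ₗ[R] Y) (Q : Type*) [AddCommGroup Q] [Module R Q] : Prop :=
  ∀ φ : X →ₗ[R] Q, ∃ ψ : Y →ₗ[R] Q, ψ ∘ₗ i = φ

variable {X Y Z Q : Type*} [AddCommGroup X] [Module R X] [AddCommGroup Y] [Module R Y]
  [AddCommGroup Z] [Module R Z] [AddCommGroup Q] [Module R Q]

lemma exists_comp_eq_of_surjective {p : Y →ₗ[R] Z} (hp : Function.Surjective p) (g : Y →ₗ[R] Q)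
    (h : ∀ y, p y = 0 → g y = 0) : ∃ k : Z →ₗ[R] Q, ∀ y, k (p y) = g y := by
  refine ⟨(LinearMap.ker p).liftQ g (fun y hy => h y hy) ∘ₗ
    (p.quotKerEquivOfSurjective hp).symm.toLinearMap, fun y => ?_⟩
  have : (p.quotKerEquivOfSurjective hp).symm (p y) = (LinearMap.ker p).mkQ y := by
    rw [LinearEquiv.symm_apply_eq]; rfl
  simp only [LinearMap.comp_apply, LinearEquiv.coe_coe, this]
  rfl

lemma isShortExact_ker {p : Y →ₗ[R] Z} (hp : Function.Surjective p) :
    IsShortExact (LinearMap.ker p).subtype p :=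
  ⟨Subtype.val_injective, fun y => by simp, hp⟩

lemma isShortExact_coker {i : X →ₗ[R] Y} (hi : Function.Injective i) :
    IsShortExact i (LinearMap.range i).mkQ :=
  ⟨hi, fun y => by simp, Submodule.mkQ_surjective _⟩

namespace IsShortExact

variable {i : X →ₗ[R] Y} {p : Y →ₗ[R] Z}

lemma apply_apply (h : IsShortExact i p) (x : X) : p (i x) = 0 :=
  (h.exact (i x)).2 ⟨x, rfl⟩

lemma exists_of_eq_zero (h : IsShortExact i p) {y : Y} (hy : p y = 0) : ∃ x, i x = y :=
  (h.exact y).1 hy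

lemma comp_equiv {Z' : Type*} [AddCommGroup Z'] [Module R Z'] (h : IsShortExact i p)
    (e : Z ≃ₗ[R] Z') : IsShortExact i (e.toLinearMap ∘ₗ p) :=
  ⟨h.inj, fun y => by simpa using h.exact y, e.surjective.comp h.surj⟩

lemma equiv_comp {X' : Type*} [AddCommGroup X'] [Module R X'] (h : IsShortExact i p)
    (e : X' ≃ₗ[R] X) : IsShortExact (i ∘ₗ e.toLinearMap) p := by
  refine ⟨h.inj.comp e.injective, fun y => (h.exact y).trans ⟨?_, ?_⟩, h.surj⟩
  · rintro ⟨x, rfl⟩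
    exact ⟨e.symm x, by simp⟩
  · rintro ⟨x, rfl⟩
    exact ⟨e x, rfl⟩

/-- Schanuel's lemma, stated for two epimorphisms onto `Z` that factor through each other. -/
lemma schanuel {K Y' : Type*} [AddCommGroup K] [Module R K] [AddCommGroup Y'] [Module R Y']
    {j : K →ₗ[R] Y'} {q : Y' →ₗ[R] Z} (h : IsShortExact i p) (h' : IsShortExact j q)
    {l : Y →ₗ[R] Y'} (hl : ∀ y, q (l y) = p y) {l' : Y' →ₗ[R] Y} (hl' : ∀ y, p (l' y) = q y) :
    Nonempty ((X × Y') ≃ₗ[R] (K × Y)) := by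
  -- Both sides embed into `Y × Y'` with image the fibre product over `Z`.
  let a : (X × Y') →ₗ[R] (Y × Y') :=
    (i.coprod l').prod (LinearMap.snd R X Y')
  let b : (K × Y) →ₗ[R] (Y × Y') :=
    (LinearMap.snd R K Y).prod (j.coprod l)
  have ha : Function.Injective a := by
    rw [injective_iff_map_eq_zero]
    rintro ⟨x, y⟩ hxy
    simp only [a, LinearMap.prod_apply, Function.prod, Prod.mk_eq_zero, LinearMap.coprod_apply,
      LinearMap.snd_apply] at hxy
    obtain ⟨h1, rfl⟩ := hxy
    simp only [map_zero, add_zero] at h1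
    simp [(injective_iff_map_eq_zero i).1 h.inj x h1]
  have hb : Function.Injective b := by
    rw [injective_iff_map_eq_zero]
    rintro ⟨x, y⟩ hxy
    simp only [b, LinearMap.prod_apply, Function.prod, Prod.mk_eq_zero, LinearMap.coprod_apply,
      LinearMap.snd_apply] at hxy
    obtain ⟨rfl, h1⟩ := hxy
    simp only [map_zero, add_zero] at h1
    simp [(injective_iff_map_eq_zero j).1 h'.inj x h1]
  have hab : LinearMap.range a = LinearMap.range b := by
    ext ⟨y, y'⟩
    have h1 : (y, y') ∈ LinearMap.range a ↔ p y = q y' := by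
      constructor
      · rintro ⟨⟨x, z⟩, hxz⟩
        simp only [a, LinearMap.prod_apply, Function.prod, Prod.mk.injEq, LinearMap.coprod_apply,
          LinearMap.snd_apply] at hxz
        obtain ⟨rfl, rfl⟩ := hxz
        simp [h.apply_apply, hl']
      · intro hy
        obtain ⟨x, hx⟩ := h.exists_of_eq_zero (y := y - l' y') (by simp [hl', hy])
        exact ⟨(x, y'), by simp [a, hx]⟩
    have h2 : (y, y') ∈ LinearMap.range b ↔ p y = q y' := by
      constructor
      · rintro ⟨⟨x, z⟩, hxz⟩
        simp only [b, LinearMap.prod_apply, Function.prod, Prod.mk.injEq, LinearMap.coprod_apply,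
          LinearMap.snd_apply] at hxz
        obtain ⟨rfl, rfl⟩ := hxz
        simp [h'.apply_apply, hl]
      · intro hy
        obtain ⟨x, hx⟩ := h'.exists_of_eq_zero (y := y' - l y) (by simp [hl, hy])
        exact ⟨(x, y), by simp [b, hx]⟩
    rw [h1, h2]
  exact ⟨(LinearEquiv.ofInjective a ha).trans ((LinearEquiv.ofEq _ _ hab).trans
    (LinearEquiv.ofInjective b hb).symm)⟩

/-- The dual of Schanuel's lemma, for two monomorphisms out of `X` that factor through each
other. -/
lemma schanuel_dual {Y' Z' : Type*} [AddCommGroup Y'] [Module R Y'] [AddCommGroup Z'] [Module R Z']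
    {j : X →ₗ[R] Y'} {q : Y' →ₗ[R] Z'} (h : IsShortExact i p) (h' : IsShortExact j q)
    {l : Y →ₗ[R] Y'} (hl : ∀ x, l (i x) = j x) {l' : Y' →ₗ[R] Y} (hl' : ∀ x, l' (j x) = i x) :
    Nonempty ((Z × Y') ≃ₗ[R] (Z' × Y)) := by
  -- Both sides are quotients of `Y × Y'` by the image of `x ↦ (i x, - j x)`.
  let a : (Y × Y') →ₗ[R] (Z × Y') :=
    (p ∘ₗ LinearMap.fst R Y Y').prod (l.coprod LinearMap.id)
  let b : (Y × Y') →ₗ[R] (Z' × Y) :=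
    (q ∘ₗ LinearMap.snd R Y Y').prod (LinearMap.id.coprod l')
  have ha : Function.Surjective a := by
    rintro ⟨z, y'⟩
    obtain ⟨y, rfl⟩ := h.surj z
    exact ⟨(y, y' - l y), by simp [a]⟩
  have hb : Function.Surjective b := by
    rintro ⟨z, y⟩
    obtain ⟨y', rfl⟩ := h'.surj z
    exact ⟨(y - l' y', y'), by simp [b]⟩
  have hab : LinearMap.ker a = LinearMap.ker b := by
    ext ⟨y, y'⟩
    have h1 : (y, y') ∈ LinearMap.ker a ↔ ∃ x, y = i x ∧ y' = - j x := by
      simp only [a, LinearMap.mem_ker, LinearMap.prod_apply, Function.prod, Prod.mk_eq_zero,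
        LinearMap.comp_apply, LinearMap.fst_apply, LinearMap.coprod_apply, LinearMap.id_apply]
      constructor
      · rintro ⟨h1, h2⟩
        obtain ⟨x, rfl⟩ := h.exists_of_eq_zero h1
        exact ⟨x, rfl, by rw [hl] at h2; exact eq_neg_of_add_eq_zero_right h2⟩
      · rintro ⟨x, rfl, rfl⟩
        simp [h.apply_apply, hl]
    have h2 : (y, y') ∈ LinearMap.ker b ↔ ∃ x, y = i x ∧ y' = - j x := by
      simp only [b, LinearMap.mem_ker, LinearMap.prod_apply, Function.prod, Prod.mk_eq_zero,
        LinearMap.comp_apply, LinearMap.snd_apply, LinearMap.coprod_apply, LinearMap.id_apply]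
      constructor
      · rintro ⟨h1, h2⟩
        obtain ⟨x, rfl⟩ := h'.exists_of_eq_zero h1
        rw [hl'] at h2
        exact ⟨-x, by simpa using eq_neg_of_add_eq_zero_left h2, by simp⟩
      · rintro ⟨x, rfl, rfl⟩
        simp [h'.apply_apply, hl']
    rw [h1, h2]
  exact ⟨(a.quotKerEquivOfSurjective ha).symm.trans ((Submodule.quotEquivOfEq _ _ hab).trans
    (b.quotKerEquivOfSurjective hb))⟩

end IsShortExact

end ShortExact

/-! ### Vanishing of `Ext¹` -/

section ExtVanishes

variable {R : Type u} [Ring R]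

/-- `Ext¹_R(G, Q) = 0`: whenever `0 → X → Y → G → 0` is exact, every map `X → Q` extends to
`Y`. -/
def ExtVanishes (R : Type u) [Ring R] (G Q : Type u) [AddCommGroup G] [Module R G]
    [AddCommGroup Q] [Module R Q] : Prop :=
  ∀ (X Y : Type u) [AddCommGroup X] [Module R X] [AddCommGroup Y] [Module R Y]
    (i : X →ₗ[R] Y) (p : Y →ₗ[R] G), IsShortExact i p → Extends i Q

variable {G Q X Y : Type u} [AddCommGroup G] [Module R G] [AddCommGroup Q] [Module R Q]
  [AddCommGroup X] [Module R X] [AddCommGroup Y] [Module R Y]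

/-- The vanishing of `Ext¹` can be tested on one projective presentation. -/
lemma IsShortExact.extVanishes [Module.Projective R Y] {i : X →ₗ[R] Y} {p : Y →ₗ[R] G}
    (h : IsShortExact i p) (hi : Extends i Q) : ExtVanishes R G Q := by
  intro A B _ _ _ _ j q h' φ
  obtain ⟨l, hl⟩ := Module.projective_lifting_property q p h'.surj
  have hl (y) : q (l y) = p y := LinearMap.congr_fun hl y
  -- the restriction of `l : Y → B` to the kernels
  let r : X →ₗ[R] A := (LinearEquiv.ofInjective j h'.inj).symm.toLinearMap ∘ₗ
    (l ∘ₗ i).codRestrict (LinearMap.range j)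
      (fun x => h'.exists_of_eq_zero (by simp [hl, h.apply_apply]))
  have hr (x) : j (r x) = l (i x) := by
    have := (LinearEquiv.ofInjective j h'.inj).apply_symm_apply
      ((l ∘ₗ i).codRestrict (LinearMap.range j)
      (fun x => h'.exists_of_eq_zero (by simp [hl, h.apply_apply])) x)
    exact congrArg Subtype.val this
  obtain ⟨ψ, hψ⟩ := hi (φ ∘ₗ r)
  have hψ (x) : ψ (i x) = φ (r x) := LinearMap.congr_fun hψ x
  -- `B` is the pushout of `A` and `Y` over `X`
  have hs : Function.Surjective (j.coprod l) := by
    intro b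
    obtain ⟨y, hy⟩ := h.surj (q b)
    obtain ⟨a, ha⟩ := h'.exists_of_eq_zero (y := b - l y) (by simp [hl, hy])
    exact ⟨(a, y), by simp [ha]⟩
  obtain ⟨k, hk⟩ := exists_comp_eq_of_surjective hs (φ.coprod ψ) (by
    rintro ⟨a, y⟩ hay
    simp only [LinearMap.coprod_apply] at hay ⊢
    obtain ⟨x, rfl⟩ := h.exists_of_eq_zero (y := y) (by
      rw [← hl]; simpa [h'.apply_apply] using congrArg q hay)
    have : a + r x = 0 := h'.inj (by simpa [hr] using hay)
    rw [hψ, ← map_add, this, map_zero])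
  refine ⟨k, LinearMap.ext fun a => ?_⟩
  simpa using hk (a, 0)

lemma ExtVanishes.of_projective [Module.Projective R G] : ExtVanishes R G Q :=
  IsShortExact.extVanishes (X := PUnit.{u+1}) (Y := G) (i := 0) (p := LinearMap.id)
    ⟨fun _ _ _ => rfl, fun y => by simp [eq_comm], fun y => ⟨y, rfl⟩⟩
    fun φ => ⟨0, LinearMap.ext fun x => by
      rw [Subsingleton.elim x 0, map_zero, map_zero]⟩

lemma ExtVanishes.of_fst (h : ExtVanishes R (G × X) Q) : ExtVanishes R G Q := by
  intro A B _ _ _ _ j q h' φ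
  obtain ⟨ψ, hψ⟩ := h A (B × X) (LinearMap.inl R B X ∘ₗ j) (q.prodMap LinearMap.id)
    ⟨fun a b hab => h'.inj (by simpa using hab), by
      rintro ⟨b, x⟩
      constructor
      · intro hb
        simp only [LinearMap.prodMap_apply, Prod.mk_eq_zero, LinearMap.id_apply] at hb
        obtain ⟨hb, rfl⟩ := hb
        obtain ⟨a, rfl⟩ := h'.exists_of_eq_zero hb
        exact ⟨a, rfl⟩
      · rintro ⟨a, ha⟩
        rw [← ha]
        simp [h'.apply_apply], h'.surj.prodMap Function.surjective_id⟩ φ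
  exact ⟨ψ ∘ₗ LinearMap.inl R B X, hψ⟩

lemma ExtVanishes.of_equiv (h : ExtVanishes R G Q) (e : X ≃ₗ[R] G) : ExtVanishes R X Q :=
  fun _ _ _ _ _ _ _ _ h' => h _ _ _ _ (h'.comp_equiv e)

/-- The class of modules `G` with `Ext¹(G, Q) = 0` is closed under extensions. -/
lemma IsShortExact.extVanishes_middle {i : X →ₗ[R] Y} {p : Y →ₗ[R] G} (h : IsShortExact i p)
    (hX : ExtVanishes R X Q) (hG : ExtVanishes R G Q) : ExtVanishes R Y Q := by
  intro A B _ _ _ _ j q h' φ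
  have hpq : Function.Surjective (p ∘ₗ q) := h.surj.comp h'.surj
  -- the sequence `0 → A → ker (B → G) → X → 0`
  let j' : A →ₗ[R] LinearMap.ker (p ∘ₗ q) :=
    j.codRestrict _ (fun a => by simp [h'.apply_apply])
  let q' : LinearMap.ker (p ∘ₗ q) →ₗ[R] X := (LinearEquiv.ofInjective i h.inj).symm.toLinearMap ∘ₗ
    (q ∘ₗ (LinearMap.ker (p ∘ₗ q)).subtype).codRestrict (LinearMap.range i)
      (fun b => h.exists_of_eq_zero b.2)
  have hq' (b) : i (q' b) = q b := by
    have := (LinearEquiv.ofInjective i h.inj).apply_symm_apply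
      ((q ∘ₗ (LinearMap.ker (p ∘ₗ q)).subtype).codRestrict (LinearMap.range i)
      (fun b => h.exists_of_eq_zero b.2) b)
    exact congrArg Subtype.val this
  have h1 : IsShortExact j' q' := by
    refine ⟨fun a b hab => h'.inj (congrArg Subtype.val hab), fun b => ⟨fun hb => ?_, ?_⟩, ?_⟩
    · obtain ⟨a, ha⟩ := h'.exists_of_eq_zero (y := b.1) (by rw [← hq', hb, map_zero])
      exact ⟨a, Subtype.ext ha⟩
    · rintro ⟨a, rfl⟩
      apply h.inj
      rw [hq', map_zero]
      exact h'.apply_apply a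
    · intro x
      obtain ⟨b, hb⟩ := h'.surj (i x)
      refine ⟨⟨b, by simp [hb, h.apply_apply]⟩, h.inj ?_⟩
      rw [hq', hb]
  obtain ⟨ψ, hψ⟩ := hX _ _ _ _ h1 φ
  obtain ⟨θ, hθ⟩ := hG _ _ _ _ (isShortExact_ker hpq) ψ
  refine ⟨θ, LinearMap.ext fun a => ?_⟩
  rw [← hψ, ← hθ]
  rfl

end ExtVanishes

/-! ### Gorenstein classes and complete resolutions -/

section GorensteinClass

variable {R : Type u} [Ring R]

/-- A class `𝒞` of modules with `Ext¹(X, Q) = 0` for `X` in `𝒞` and `Q` projective, in which every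
module has a syzygy and a cosyzygy (the cokernel of an embedding into a projective module) that
again belong to `𝒞`. -/
structure IsGorensteinClass (R : Type u) [Ring R]
    (𝒞 : ∀ (X : Type u) [AddCommGroup X] [Module R X], Prop) : Prop where
  syzygy : ∀ (X : Type u) [AddCommGroup X] [Module R X], 𝒞 X →
    ∃ (K P : Type u) (_ : AddCommGroup K) (_ : Module R K) (_ : AddCommGroup P) (_ : Module R P)
      (i : K →ₗ[R] P) (p : P →ₗ[R] X), Module.Projective R P ∧ 𝒞 K ∧ IsShortExact i p
  cosyzygy : ∀ (X : Type u) [AddCommGroup X] [Module R X], 𝒞 X →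
    ∃ (P C : Type u) (_ : AddCommGroup P) (_ : Module R P) (_ : AddCommGroup C) (_ : Module R C)
      (i : X →ₗ[R] P) (p : P →ₗ[R] C), Module.Projective R P ∧ 𝒞 C ∧ IsShortExact i p
  ext : ∀ (X Q : Type u) [AddCommGroup X] [Module R X] [AddCommGroup Q] [Module R Q], 𝒞 X →
    Module.Projective R Q → ExtVanishes R X Q

/-- A relation that is total in both directions admits a `ℤ`-indexed chain through any point; the
point is placed at index `1` because a Gorenstein projective module is the image of `P 0 → P 1`. -/
lemma exists_int_chain {α : Type*} {r : α → α → Prop} (hs : ∀ a, ∃ b, r a b)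
    (ht : ∀ b, ∃ a, r a b) (x : α) : ∃ G : ℤ → α, G 1 = x ∧ ∀ n, r (G n) (G (n + 1)) := by
  choose s hs using hs
  choose t ht using ht
  let F : ℤ → α := fun n => match n with
    | Int.ofNat n => s^[n] x
    | Int.negSucc n => t^[n + 1] x
  suffices hF : ∀ n, r (F n) (F (n + 1)) by
    refine ⟨fun n => F (n - 1), rfl, fun n => ?_⟩
    have := hF (n - 1)
    rwa [show n - 1 + 1 = n + 1 - 1 by ring] at this
  intro n
  match n with
  | Int.ofNat n =>
    change r (s^[n] x) (s^[n + 1] x)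
    rw [Function.iterate_succ_apply']
    exact hs _
  | Int.negSucc 0 => exact ht x
  | Int.negSucc (n + 1) =>
    change r (t^[n + 1 + 1] x) (t^[n + 1] x)
    rw [Function.iterate_succ_apply' t (n + 1)]
    exact ht _

lemma IsGorensteinProjective.of_equiv {X Y : Type u} [AddCommGroup X] [Module R X]
    [AddCommGroup Y] [Module R Y] (h : IsGorensteinProjective R X) (e : Y ≃ₗ[R] X) :
    IsGorensteinProjective R Y := by
  obtain ⟨P, i1, i2, d, h1, h2, h3, ⟨f⟩⟩ := h
  exact ⟨P, i1, i2, d, h1, h2, h3, ⟨e.trans f⟩⟩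

/-- Coinduction principle: the members of a Gorenstein class are Gorenstein projective, since
their syzygies and cosyzygies in the class can be spliced into a complete resolution. -/
theorem IsGorensteinClass.isGorensteinProjective
    {𝒞 : ∀ (X : Type u) [AddCommGroup X] [Module R X], Prop} (h : IsGorensteinClass R 𝒞)
    {X : Type u} [AddCommGroup X] [Module R X] (hX : 𝒞 X) : IsGorensteinProjective R X := by
  let α := {M : ModuleCat.{u} R // 𝒞 M}
  let r : α → α → Prop := fun M N =>
    ∃ (P : Type u) (_ : AddCommGroup P) (_ : Module R P) (i : M.1 →ₗ[R] P) (p : P →ₗ[R] N.1),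
      Module.Projective R P ∧ IsShortExact i p
  obtain ⟨G, hG0, hG⟩ := exists_int_chain (r := r)
    (fun M => by
      obtain ⟨P, C, _, _, _, _, i, p, hP, hC, hip⟩ := h.cosyzygy _ M.2
      exact ⟨⟨ModuleCat.of R C, hC⟩, P, _, _, i, p, hP, hip⟩)
    (fun M => by
      obtain ⟨K, P, _, _, _, _, i, p, hP, hK, hip⟩ := h.syzygy _ M.2
      exact ⟨⟨ModuleCat.of R K, hK⟩, P, _, _, i, p, hP, hip⟩)
    ⟨ModuleCat.of R X, hX⟩
  choose P i1 i2 i p hP hip using hG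
  have hip0 (n x) : p n (i n x) = 0 := (hip n).apply_apply x
  refine ⟨P, i1, i2, fun n => i (n + 1) ∘ₗ p n, hP, fun n x => ?_, fun Q _ _ hQ n φ => ?_, ?_⟩
  · rw [LinearMap.comp_apply, map_eq_zero_iff _ (hip _).inj, (hip (n + 1)).exact x]
    constructor
    · rintro ⟨g, rfl⟩
      obtain ⟨y, rfl⟩ := (hip n).surj g
      exact ⟨y, rfl⟩
    · rintro ⟨y, rfl⟩
      exact ⟨p n y, rfl⟩
  · constructor
    · intro hφ
      obtain ⟨k, hk⟩ := exists_comp_eq_of_surjective (hip (n + 1)).surj φ (by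
        intro y hy
        obtain ⟨g, rfl⟩ := (hip (n + 1)).exists_of_eq_zero hy
        obtain ⟨z, rfl⟩ := (hip n).surj g
        exact LinearMap.congr_fun hφ z)
      obtain ⟨ψ, hψ⟩ := h.ext _ Q (G (n + 1 + 1 + 1)).2 hQ _ _ _ _ (hip (n + 1 + 1)) k
      exact ⟨ψ, LinearMap.ext fun y => (LinearMap.congr_fun hψ _).trans (hk y)⟩
    · rintro ⟨ψ, rfl⟩
      exact LinearMap.ext fun y => by simp [hip0]
  · have hr : LinearMap.range (i 1) = LinearMap.range (i 1 ∘ₗ p 0) :=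
      (LinearMap.range_comp_of_range_eq_top _ (LinearMap.range_eq_top.2 (hip 0).surj)).symm
    let M : α := ⟨ModuleCat.of R X, hX⟩
    have e : Nonempty (M.1 ≃ₗ[R] (G 1).1) := by
      rw [hG0]
      exact ⟨LinearEquiv.refl R _⟩
    obtain ⟨e⟩ := e
    exact ⟨e.trans ((LinearEquiv.ofInjective (i 1) (hip 1).inj).trans (LinearEquiv.ofEq _ _ hr))⟩

/-- The Gorenstein projective modules themselves form a Gorenstein class. -/
theorem isGorensteinClass_isGorensteinProjective :
    IsGorensteinClass R (IsGorensteinProjective R) := by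
  -- All images in complete resolutions, in any degree.
  let 𝒟 : ∀ (X : Type u) [AddCommGroup X] [Module R X], Prop := fun X _ _ =>
    ∃ (P : ℤ → Type u) (_ : ∀ i, AddCommGroup (P i)) (_ : ∀ i, Module R (P i))
      (d : ∀ i : ℤ, P i →ₗ[R] P (i + 1)),
      (∀ i, Module.Projective R (P i)) ∧
      (∀ i, Function.Exact (d i) (d (i + 1))) ∧
      (∀ (Q : Type u) [AddCommGroup Q] [Module R Q], Module.Projective R Q →
        ∀ i, Function.Exact (fun φ : P (i + 1 + 1) →ₗ[R] Q => φ ∘ₗ d (i + 1))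
          (fun φ : P (i + 1) →ₗ[R] Q => φ ∘ₗ d i)) ∧
      ∃ i, Nonempty (X ≃ₗ[R] LinearMap.range (d i))
  have hses (P : ℤ → Type u) [∀ i, AddCommGroup (P i)] [∀ i, Module R (P i)]
      (d : ∀ i : ℤ, P i →ₗ[R] P (i + 1)) (hd : ∀ i, Function.Exact (d i) (d (i + 1))) (n : ℤ) :
      IsShortExact (LinearMap.range (d n)).subtype (d (n + 1)).rangeRestrict :=
    ⟨Subtype.val_injective, fun y => by
      rw [Submodule.coe_subtype, Subtype.range_coe, SetLike.mem_coe,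
        ← (hd n).linearMap_ker_eq, LinearMap.mem_ker]
      exact Subtype.ext_iff, LinearMap.surjective_rangeRestrict _⟩
  have h𝒟 : IsGorensteinClass R 𝒟 := by
    refine ⟨?_, ?_, ?_⟩
    · rintro X _ _ ⟨P, _, _, d, h1, h2, h3, n, ⟨e⟩⟩
      obtain ⟨n, rfl⟩ : ∃ m, n = m + 1 := ⟨n - 1, by ring⟩
      exact ⟨_, _, _, _, _, _, _, _, h1 _, ⟨P, _, _, d, h1, h2, h3, n, ⟨LinearEquiv.refl R _⟩⟩,
        (hses P d h2 n).comp_equiv e.symm⟩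
    · rintro X _ _ ⟨P, _, _, d, h1, h2, h3, n, ⟨e⟩⟩
      exact ⟨_, _, _, _, _, _, _, _, h1 _, ⟨P, _, _, d, h1, h2, h3, n + 1, ⟨LinearEquiv.refl R _⟩⟩,
        (hses P d h2 n).equiv_comp e⟩
    · rintro X Q _ _ _ _ ⟨P, _, _, d, h1, h2, h3, n, ⟨e⟩⟩ hQ
      obtain ⟨n, rfl⟩ : ∃ m, n = m + 1 + 1 := ⟨n - 2, by ring⟩
      have := h1 (n + 1 + 1)
      refine (IsShortExact.extVanishes (hses P d h2 (n + 1)) fun φ => ?_).of_equiv e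
      obtain ⟨ψ, hψ⟩ := (h3 Q hQ n (φ ∘ₗ (d (n + 1)).rangeRestrict)).1 (LinearMap.ext fun y =>
        (congrArg φ (Subtype.ext ((h2 n _).2 ⟨y, rfl⟩))).trans (map_zero φ))
      refine ⟨ψ, LinearMap.ext ?_⟩
      rintro ⟨_, y, rfl⟩
      exact LinearMap.congr_fun hψ y
  have hle (X : Type u) [AddCommGroup X] [Module R X] (hX : 𝒟 X) : IsGorensteinProjective R X :=
    h𝒟.isGorensteinProjective hX
  have hge (X : Type u) [AddCommGroup X] [Module R X] (hX : IsGorensteinProjective R X) : 𝒟 X := by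
    obtain ⟨P, i1, i2, d, h1, h2, h3, e⟩ := hX
    exact ⟨P, i1, i2, d, h1, h2, h3, 0, e⟩
  refine ⟨fun X _ _ hX => ?_, fun X _ _ hX => ?_, fun X Q _ _ _ _ hX => h𝒟.ext X Q (hge X hX)⟩
  · obtain ⟨K, P, _, _, _, _, i, p, hP, hK, h⟩ := h𝒟.syzygy X (hge X hX)
    exact ⟨K, P, _, _, _, _, i, p, hP, hle K hK, h⟩
  · obtain ⟨P, C, _, _, _, _, i, p, hP, hC, h⟩ := h𝒟.cosyzygy X (hge X hX)
    exact ⟨P, C, _, _, _, _, i, p, hP, hle C hC, h⟩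

end GorensteinClass

/-! ### Closure properties of Gorenstein projective modules -/

section GorensteinProjective

variable {R : Type u} [Ring R] {X Y Z P : Type u} [AddCommGroup X] [Module R X]
  [AddCommGroup Y] [Module R Y] [AddCommGroup Z] [Module R Z] [AddCommGroup P] [Module R P]

lemma IsGorensteinProjective.extVanishes (h : IsGorensteinProjective R X) (Q : Type u)
    [AddCommGroup Q] [Module R Q] [Module.Projective R Q] : ExtVanishes R X Q :=
  isGorensteinClass_isGorensteinProjective.ext X Q h inferInstance

theorem IsGorensteinProjective.of_projective [Module.Projective R X] :
    IsGorensteinProjective R X := by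
  refine IsGorensteinClass.isGorensteinProjective
    (𝒞 := fun X _ _ => Module.Projective R X) ⟨?_, ?_, ?_⟩ inferInstance
  · intro X _ _ hX
    exact ⟨PUnit, X, _, _, _, _, 0, LinearMap.id, hX, inferInstance,
      fun _ _ _ => rfl, fun y => by simp [eq_comm], fun y => ⟨y, rfl⟩⟩
  · intro X _ _ hX
    exact ⟨X, PUnit, _, _, _, _, LinearMap.id, 0, hX, inferInstance,
      fun _ _ h => h, fun y => by simp, fun y => ⟨0, rfl⟩⟩
  · intro X Q _ _ _ _ hX _
    exact ExtVanishes.of_projective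

/-- The horseshoe lemma for syzygies: from syzygies `K` of `X` and `K'` of `Z`, it gives a syzygy
of `Y`, the kernel of an epimorphism `P × P' → Y`, that is an extension of `K'` by `K`. -/
lemma IsShortExact.horseshoe_syzygy {i : X →ₗ[R] Y} {p : Y →ₗ[R] Z} (h : IsShortExact i p)
    {K K' P' : Type u} [AddCommGroup K] [Module R K] [AddCommGroup K'] [Module R K']
    [AddCommGroup P'] [Module R P'] [Module.Projective R P']
    {j : K →ₗ[R] P} {q : P →ₗ[R] X} (hX : IsShortExact j q)
    {j' : K' →ₗ[R] P'} {q' : P' →ₗ[R] Z} (hZ : IsShortExact j' q') :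
    ∃ s : (P × P') →ₗ[R] Y, Function.Surjective s ∧
      ∃ (a : K →ₗ[R] LinearMap.ker s) (b : LinearMap.ker s →ₗ[R] K'), IsShortExact a b := by
  obtain ⟨l, hl⟩ := Module.projective_lifting_property p q' h.surj
  have hl (y) : p (l y) = q' y := LinearMap.congr_fun hl y
  let s : (P × P') →ₗ[R] Y := (i ∘ₗ q).coprod l
  have hs (x y) : s (x, y) = i (q x) + l y := rfl
  have hs' (z) (hz : z ∈ LinearMap.ker s) : q' z.2 = 0 := by
    have : i (q z.1) + l z.2 = 0 := hz
    simpa [h.apply_apply, hl] using congrArg p this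
  refine ⟨s, fun y => ?_, ?_⟩
  · obtain ⟨z, hz⟩ := hZ.surj (p y)
    obtain ⟨x, hx⟩ := h.exists_of_eq_zero (y := y - l z) (by simp [hl, hz])
    obtain ⟨w, rfl⟩ := hX.surj x
    exact ⟨(w, z), by simp [hs, hx]⟩
  · let b' : LinearMap.ker s →ₗ[R] LinearMap.range j' :=
      (LinearMap.snd R P P' ∘ₗ (LinearMap.ker s).subtype).codRestrict _
        (fun z => hZ.exists_of_eq_zero (hs' z.1 z.2))
    let b : LinearMap.ker s →ₗ[R] K' := (LinearEquiv.ofInjective j' hZ.inj).symm.toLinearMap ∘ₗ b'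
    have hb (z) : j' (b z) = z.1.2 :=
      congrArg Subtype.val ((LinearEquiv.ofInjective j' hZ.inj).apply_symm_apply (b' z))
    refine ⟨(LinearMap.inl R P P' ∘ₗ j).codRestrict _ fun k => by simp [hs, hX.apply_apply], b,
      fun x y hxy => hX.inj (congrArg (fun z => z.1.1) hxy), fun z => ⟨fun hz => ?_, ?_⟩,
      fun k => ?_⟩
    · have h2 : z.1.2 = 0 := by rw [← hb, hz, map_zero]
      have h1 : i (q z.1.1) + l z.1.2 = 0 := z.2
      obtain ⟨k, hk⟩ := hX.exists_of_eq_zero (y := z.1.1)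
        (h.inj (by rw [h2] at h1; simpa using h1))
      exact ⟨k, Subtype.ext (Prod.ext hk h2.symm)⟩
    · rintro ⟨k, rfl⟩
      exact hZ.inj ((hb _).trans (map_zero j').symm)
    · obtain ⟨x, hx⟩ := h.exists_of_eq_zero (y := l (j' k)) (by rw [hl, hZ.apply_apply])
      obtain ⟨w, rfl⟩ := hX.surj x
      exact ⟨⟨(-w, j' k), by simp [hs, hx]⟩, hZ.inj (hb _)⟩

/-- The horseshoe lemma for cosyzygies, the cokernels of embeddings into `P`, `P'` and `P × P'`.
The projectivity used for syzygies is replaced by the assumption that maps `X → P` extend to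
`Y`. -/
lemma IsShortExact.horseshoe_cosyzygy {i : X →ₗ[R] Y} {p : Y →ₗ[R] Z} (h : IsShortExact i p)
    {C C' P' : Type u} [AddCommGroup C] [Module R C] [AddCommGroup C'] [Module R C']
    [AddCommGroup P'] [Module R P']
    {j : X →ₗ[R] P} {q : P →ₗ[R] C} (hX : IsShortExact j q) (hi : Extends i P)
    {j' : Z →ₗ[R] P'} {q' : P' →ₗ[R] C'} (hZ : IsShortExact j' q') :
    ∃ s : Y →ₗ[R] (P × P'), Function.Injective s ∧
      ∃ (a : C →ₗ[R] (P × P') ⧸ LinearMap.range s) (b : ((P × P') ⧸ LinearMap.range s) →ₗ[R] C'),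
        IsShortExact a b := by
  obtain ⟨l, hl⟩ := hi j
  have hl (x) : l (i x) = j x := LinearMap.congr_fun hl x
  let s : Y →ₗ[R] (P × P') := l.prod (j' ∘ₗ p)
  have hs (y) : s y = (l y, j' (p y)) := rfl
  refine ⟨s, ?_, ?_⟩
  · rw [injective_iff_map_eq_zero]
    intro y hy
    rw [hs, Prod.mk_eq_zero, map_eq_zero_iff _ hZ.inj] at hy
    obtain ⟨h1, h2⟩ := hy
    obtain ⟨x, rfl⟩ := h.exists_of_eq_zero h2
    rw [hl, map_eq_zero_iff _ hX.inj] at h1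
    rw [h1, map_zero]
  · obtain ⟨a, ha⟩ := exists_comp_eq_of_surjective hX.surj
      ((LinearMap.range s).mkQ ∘ₗ LinearMap.inl R P P') (by
        intro y hy
        obtain ⟨x, rfl⟩ := hX.exists_of_eq_zero hy
        simp only [LinearMap.comp_apply, Submodule.mkQ_apply, Submodule.Quotient.mk_eq_zero]
        exact ⟨i x, by simp [hs, hl, h.apply_apply]⟩)
    have hab (y) : (q' ∘ₗ LinearMap.snd R P P') (s y) = 0 := by simp [hs, hZ.apply_apply]
    refine ⟨a, (LinearMap.range s).liftQ (q' ∘ₗ LinearMap.snd R P P')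
      (by rintro _ ⟨y, rfl⟩; exact hab y), ?_, ?_, ?_⟩
    · rw [injective_iff_map_eq_zero]
      intro c hc
      obtain ⟨z, rfl⟩ := hX.surj c
      rw [ha] at hc
      obtain ⟨y, hy⟩ := (Submodule.Quotient.mk_eq_zero _).1 hc
      rw [hs, LinearMap.inl_apply, Prod.mk.injEq, map_eq_zero_iff _ hZ.inj] at hy
      obtain ⟨x, rfl⟩ := h.exists_of_eq_zero hy.2
      rw [← hy.1, hl, hX.apply_apply]
    · intro c
      obtain ⟨⟨y, z⟩, rfl⟩ := Submodule.mkQ_surjective _ c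
      constructor
      · intro hz
        obtain ⟨x, rfl⟩ := hZ.exists_of_eq_zero (y := z) hz
        obtain ⟨w, rfl⟩ := h.surj x
        refine ⟨q (y - l w), ?_⟩
        rw [ha, ← sub_eq_zero, LinearMap.comp_apply, ← map_sub]
        refine (Submodule.Quotient.mk_eq_zero _).2 ⟨-w, ?_⟩
        rw [map_neg, hs]
        simp
      · rintro ⟨c, hc⟩
        obtain ⟨x, rfl⟩ := hX.surj c
        rw [← hc, ha]
        simp
    · intro c
      obtain ⟨z, rfl⟩ := hZ.surj c
      exact ⟨(LinearMap.range s).mkQ (0, z), rfl⟩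

/-- The Gorenstein projective modules are closed under extensions. -/
theorem IsShortExact.isGorensteinProjective {i : X →ₗ[R] Y} {p : Y →ₗ[R] Z}
    (h : IsShortExact i p) (hX : IsGorensteinProjective R X) (hZ : IsGorensteinProjective R Z) :
    IsGorensteinProjective R Y := by
  refine IsGorensteinClass.isGorensteinProjective
    (𝒞 := fun Y _ _ => ∃ (X Z : Type u) (_ : AddCommGroup X) (_ : Module R X)
      (_ : AddCommGroup Z) (_ : Module R Z) (i : X →ₗ[R] Y) (p : Y →ₗ[R] Z),
      IsGorensteinProjective R X ∧ IsGorensteinProjective R Z ∧ IsShortExact i p) ⟨?_, ?_, ?_⟩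
    ⟨X, Z, _, _, _, _, i, p, hX, hZ, h⟩
  · rintro Y _ _ ⟨X, Z, _, _, _, _, i, p, hX, hZ, h⟩
    obtain ⟨K, P, _, _, _, _, j, q, _, hK, hq⟩ :=
      isGorensteinClass_isGorensteinProjective.syzygy X hX
    obtain ⟨K', P', _, _, _, _, j', q', _, hK', hq'⟩ :=
      isGorensteinClass_isGorensteinProjective.syzygy Z hZ
    obtain ⟨s, hs, a, b, hab⟩ := h.horseshoe_syzygy hq hq'
    exact ⟨_, P × P', _, _, _, _, _, s, inferInstance, ⟨K, K', _, _, _, _, a, b, hK, hK', hab⟩,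
      isShortExact_ker hs⟩
  · rintro Y _ _ ⟨X, Z, _, _, _, _, i, p, hX, hZ, h⟩
    obtain ⟨P, C, _, _, _, _, j, q, _, hC, hq⟩ :=
      isGorensteinClass_isGorensteinProjective.cosyzygy X hX
    obtain ⟨P', C', _, _, _, _, j', q', _, hC', hq'⟩ :=
      isGorensteinClass_isGorensteinProjective.cosyzygy Z hZ
    obtain ⟨s, hs, a, b, hab⟩ := h.horseshoe_cosyzygy hq (hZ.extVanishes P _ _ _ _ h) hq'
    exact ⟨P × P', _, _, _, _, _, s, _, inferInstance, ⟨C, C', _, _, _, _, a, b, hC, hC', hab⟩,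
      isShortExact_coker hs⟩
  · rintro Y Q _ _ _ _ ⟨X, Z, _, _, _, _, i, p, hX, hZ, h⟩ hQ
    exact h.extVanishes_middle (hX.extVanishes Q) (hZ.extVanishes Q)

lemma IsGorensteinProjective.prod (hX : IsGorensteinProjective R X)
    (hY : IsGorensteinProjective R Y) : IsGorensteinProjective R (X × Y) :=
  IsShortExact.isGorensteinProjective (i := LinearMap.inl R X Y) (p := LinearMap.snd R X Y)
    ⟨LinearMap.inl_injective, Function.Exact.inl_snd, LinearMap.snd_surjective⟩ hX hY

/-- Projective direct factors can be cancelled from Gorenstein projective modules. -/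
theorem IsGorensteinProjective.of_prod [Module.Projective R P]
    (h : IsGorensteinProjective R (X × P)) : IsGorensteinProjective R X := by
  refine IsGorensteinClass.isGorensteinProjective
    (𝒞 := fun X _ _ => ∃ (P : Type u) (_ : AddCommGroup P) (_ : Module R P),
      Module.Projective R P ∧ IsGorensteinProjective R (X × P)) ⟨?_, ?_, ?_⟩
    ⟨P, _, _, inferInstance, h⟩
  · rintro X _ _ ⟨P, _, _, _, h⟩
    obtain ⟨K, F, _, _, _, _, i, p, hF, hK, hp⟩ :=
      isGorensteinClass_isGorensteinProjective.syzygy _ h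
    -- the kernel of `F → X × P → X` is an extension of `P` by `K`
    let s : F →ₗ[R] X := LinearMap.fst R X P ∘ₗ p
    have hs : Function.Surjective s := (LinearMap.fst_surjective (R := R)).comp hp.surj
    have hL : IsShortExact (i.codRestrict (LinearMap.ker s) fun k => by simp [s, hp.apply_apply])
        (LinearMap.snd R X P ∘ₗ p ∘ₗ (LinearMap.ker s).subtype) := by
      refine ⟨fun x y hxy => hp.inj (congrArg Subtype.val hxy), fun f => ⟨fun hf => ?_, ?_⟩,
        fun z => ?_⟩
      · obtain ⟨k, hk⟩ := hp.exists_of_eq_zero (y := f.1) (Prod.ext f.2 hf)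
        exact ⟨k, Subtype.ext hk⟩
      · rintro ⟨k, rfl⟩
        simp [hp.apply_apply]
      · obtain ⟨f, hf⟩ := hp.surj (0, z)
        exact ⟨⟨f, by simp [s, hf]⟩, by simp [hf]⟩
    exact ⟨_, F, _, _, _, _, _, s, hF, ⟨P, _, _, inferInstance,
      (hL.isGorensteinProjective hK .of_projective).prod (.of_projective (X := P))⟩,
      isShortExact_ker hs⟩
  · rintro X _ _ ⟨P, _, _, _, h⟩
    obtain ⟨F, C, _, _, _, _, i, p, hF, hC, hp⟩ :=
      isGorensteinClass_isGorensteinProjective.cosyzygy _ h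
    -- the cokernel of `X → X × P → F` is an extension of `C` by `P`
    let s : X →ₗ[R] F := i ∘ₗ LinearMap.inl R X P
    have hs : Function.Injective s := hp.inj.comp LinearMap.inl_injective
    have hL : IsShortExact ((LinearMap.range s).mkQ ∘ₗ i ∘ₗ LinearMap.inr R X P)
        ((LinearMap.range s).liftQ p (by rintro _ ⟨x, rfl⟩; exact hp.apply_apply _)) := by
      refine ⟨?_, fun c => ?_, fun c => ?_⟩
      · rw [injective_iff_map_eq_zero]
        intro z hz
        obtain ⟨x, hx⟩ := (Submodule.Quotient.mk_eq_zero _).1 hz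
        exact (congrArg Prod.snd (hp.inj hx)).symm
      · obtain ⟨f, rfl⟩ := Submodule.mkQ_surjective _ c
        constructor
        · intro hf
          obtain ⟨⟨x, z⟩, rfl⟩ := hp.exists_of_eq_zero (y := f) hf
          refine ⟨z, (Submodule.Quotient.eq _).2 ⟨-x, ?_⟩⟩
          simp [s, ← map_sub]
        · rintro ⟨z, hz⟩
          rw [← hz]
          exact hp.apply_apply _
      · obtain ⟨f, rfl⟩ := hp.surj c
        exact ⟨(LinearMap.range s).mkQ f, rfl⟩
    exact ⟨F, _, _, _, _, _, s, _, hF, ⟨P, _, _, inferInstance,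
      (hL.isGorensteinProjective .of_projective hC).prod (.of_projective (X := P))⟩,
      isShortExact_coker hs⟩
  · rintro X Q _ _ _ _ ⟨P, _, _, _, h⟩ hQ
    exact (h.extVanishes Q).of_fst

/-- Every syzygy of a Gorenstein projective module is Gorenstein projective. -/
theorem IsGorensteinProjective.syzygy [Module.Projective R Y] {i : X →ₗ[R] Y} {p : Y →ₗ[R] Z}
    (hZ : IsGorensteinProjective R Z) (h : IsShortExact i p) : IsGorensteinProjective R X := by
  obtain ⟨K, F, _, _, _, _, j, q, hF, hK, hq⟩ :=
    isGorensteinClass_isGorensteinProjective.syzygy _ hZ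
  obtain ⟨l, hl⟩ := Module.projective_lifting_property q p hq.surj
  obtain ⟨l', hl'⟩ := Module.projective_lifting_property p q h.surj
  obtain ⟨e⟩ := h.schanuel hq (LinearMap.congr_fun hl) (LinearMap.congr_fun hl')
  exact ((hK.prod (.of_projective (X := Y))).of_equiv e).of_prod

/-- If `X → Y` is an embedding of a Gorenstein projective module into a projective module along
which every map to a projective module extends, then its cokernel is Gorenstein projective. -/
theorem IsGorensteinProjective.cosyzygy [Module.Projective R Y] {i : X →ₗ[R] Y} {p : Y →ₗ[R] Z}
    (hX : IsGorensteinProjective R X) (h : IsShortExact i p)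
    (hi : ∀ (Q : Type u) [AddCommGroup Q] [Module R Q], Module.Projective R Q → Extends i Q) :
    IsGorensteinProjective R Z := by
  obtain ⟨F, C, _, _, _, _, j, q, hF, hC, hq⟩ :=
    isGorensteinClass_isGorensteinProjective.cosyzygy _ hX
  obtain ⟨l, hl⟩ := hi F hF j
  obtain ⟨l', hl'⟩ := hC.extVanishes Y _ _ _ _ hq i
  obtain ⟨e⟩ := h.schanuel_dual hq (LinearMap.congr_fun hl) (LinearMap.congr_fun hl')
  exact ((hC.prod (.of_projective (X := Y))).of_equiv e).of_prod

end GorensteinProjective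

/-! ### Duality with respect to a bimodule -/

section Duality

/-- The `R`-`S`-bimodule `D` (both actions written on the left) has an element `e` such that
`r ↦ r • e` and `s ↦ s • e` are isomorphisms `R ≃ D` and `S ≃ D`. The main example is `D = R` with
`S = Rᵐᵒᵖ`. The condition is symmetric in `R` and `S`, so that left and right modules over a ring,
with their duals `Hom(-, D)`, are treated on an equal footing. -/
def IsDualizing (R S D : Type*) [Ring R] [Ring S] [AddCommGroup D] [Module R D] [Module S D] :
    Prop :=
  ∃ (a : R ≃ₗ[R] D) (b : S ≃ₗ[S] D), a 1 = b 1

lemma IsDualizing.symm {R S D : Type*} [Ring R] [Ring S] [AddCommGroup D] [Module R D]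
    [Module S D] (h : IsDualizing R S D) : IsDualizing S R D := by
  obtain ⟨a, b, hab⟩ := h
  exact ⟨b, a, hab.symm⟩

lemma isDualizing_mulOpposite (R : Type*) [Ring R] : IsDualizing R Rᵐᵒᵖ R :=
  ⟨LinearEquiv.refl R R, { MulOpposite.opAddEquiv.symm with map_smul' := fun _ _ => rfl }, rfl⟩

variable {R S D : Type u} [Ring R] [Ring S] [AddCommGroup D] [Module R D] [Module S D]
  [SMulCommClass R S D]

/-- The evaluation map from `X` to its bidual with respect to the bimodule `D`. -/
def evalDual (R S D : Type*) [Ring R] [Ring S] [AddCommGroup D] [Module R D] [Module S D]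
    [SMulCommClass R S D] [SMulCommClass S R D] (X : Type*) [AddCommGroup X] [Module R X] :
    X →ₗ[R] ((X →ₗ[R] D) →ₗ[S] D) where
  toFun x :=
    { toFun := fun φ => φ x
      map_add' := fun _ _ => rfl
      map_smul' := fun _ _ => rfl }
  map_add' x y := LinearMap.ext fun φ => map_add φ x y
  map_smul' r x := LinearMap.ext fun φ => map_smul φ r x

@[simp]
lemma evalDual_apply {X : Type*} [AddCommGroup X] [Module R X] [SMulCommClass S R D] (x : X)
    (φ : X →ₗ[R] D) :
    evalDual R S D X x φ = φ x :=
  rfl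

section

variable {X Y Z : Type*} [AddCommGroup X] [Module R X] [AddCommGroup Y] [Module R Y]
  [AddCommGroup Z] [Module R Z]

lemma IsShortExact.dual {i : X →ₗ[R] Y} {p : Y →ₗ[R] Z} (h : IsShortExact i p)
    (hi : Extends i D) : IsShortExact (LinearMap.lcomp S D p) (LinearMap.lcomp S D i) := by
  refine ⟨fun φ ψ hφ => ?_, fun φ => ⟨fun hφ => ?_, ?_⟩, hi⟩
  · ext z
    obtain ⟨y, rfl⟩ := h.surj z
    exact LinearMap.congr_fun hφ y
  · obtain ⟨k, hk⟩ := exists_comp_eq_of_surjective h.surj φ (by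
      intro y hy
      obtain ⟨x, rfl⟩ := h.exists_of_eq_zero hy
      exact LinearMap.congr_fun hφ x)
    exact ⟨k, LinearMap.ext hk⟩
  · rintro ⟨k, rfl⟩
    ext x
    simp [h.apply_apply]

/-- The dual basis lemma; the coordinate functions take values in `D ≅ R`. -/
lemma exists_dual_basis (a : R ≃ₗ[R] D) [Module.Finite R X] [Module.Projective R X] :
    ∃ (n : ℕ) (φ : Fin n → X →ₗ[R] D) (v : Fin n → X), ∀ x, ∑ k, a.symm (φ k x) • v k = x := by
  obtain ⟨n, f, hf⟩ := Module.Finite.exists_fin' R X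
  obtain ⟨s, hs⟩ := Module.projective_lifting_property f LinearMap.id hf
  refine ⟨n, fun k => a.toLinearMap ∘ₗ LinearMap.proj k ∘ₗ s, fun k => f (Pi.single k 1),
    fun x => ?_⟩
  conv_rhs => rw [show x = f (s x) from (LinearMap.congr_fun hs x).symm,
    pi_eq_sum_univ' (s x), map_sum]
  refine Finset.sum_congr rfl fun k _ => ?_
  rw [map_smul]
  simp

lemma dual_eq_sum {a : R ≃ₗ[R] D} {b : S ≃ₗ[S] D} (hab : a 1 = b 1) {n : ℕ}
    {φ : Fin n → X →ₗ[R] D} {v : Fin n → X} (h : ∀ x, ∑ k, a.symm (φ k x) • v k = x)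
    (ψ : X →ₗ[R] D) : ∑ k, b.symm (ψ (v k)) • φ k = ψ := by
  ext x
  have ha (d : D) : a.symm d • a 1 = d := by
    rw [← map_smul, smul_eq_mul, mul_one, a.apply_symm_apply]
  have hb (d : D) : b.symm d • b 1 = d := by
    rw [← map_smul, smul_eq_mul, mul_one, b.apply_symm_apply]
  conv_rhs => rw [← h x, map_sum]
  rw [LinearMap.sum_apply]
  refine Finset.sum_congr rfl fun k _ => ?_
  rw [map_smul, LinearMap.smul_apply]
  nth_rw 1 [← ha (φ k x)]
  nth_rw 2 [← hb (ψ (v k))]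
  rw [hab]
  exact (smul_comm _ _ _).symm

variable [Module.Finite R X] [Module.Projective R X]

theorem IsDualizing.finite_dual_of_projective (hD : IsDualizing R S D) :
    Module.Finite S (X →ₗ[R] D) := by
  obtain ⟨a, b, hab⟩ := hD
  obtain ⟨n, φ, v, h⟩ := exists_dual_basis (X := X) a
  refine Module.Finite.of_surjective (Fintype.linearCombination S φ) fun ψ =>
    ⟨fun k => b.symm (ψ (v k)), ?_⟩
  rw [Fintype.linearCombination_apply]
  exact dual_eq_sum hab h ψ

variable [SMulCommClass S R D]

theorem IsDualizing.evalDual_bijective_of_projective (hD : IsDualizing R S D) :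
    Function.Bijective (evalDual R S D X) := by
  obtain ⟨a, b, hab⟩ := hD
  obtain ⟨n, φ, v, h⟩ := exists_dual_basis (X := X) a
  constructor
  · rw [injective_iff_map_eq_zero]
    intro x hx
    rw [← h x]
    refine Finset.sum_eq_zero fun k _ => ?_
    rw [← evalDual_apply (S := S) x (φ k), hx]
    simp
  · intro Φ
    refine ⟨∑ k, a.symm (Φ (φ k)) • v k, LinearMap.ext fun ψ => ?_⟩
    have ha (d : D) : a.symm d • a 1 = d := by
      rw [← map_smul, smul_eq_mul, mul_one, a.apply_symm_apply]
    have hb (d : D) : b.symm d • b 1 = d := by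
      rw [← map_smul, smul_eq_mul, mul_one, b.apply_symm_apply]
    rw [evalDual_apply, map_sum]
    conv_rhs => rw [← dual_eq_sum hab h ψ, map_sum]
    refine Finset.sum_congr rfl fun k _ => ?_
    rw [map_smul, map_smul]
    nth_rw 1 [← hb (ψ (v k))]
    nth_rw 2 [← ha (Φ (φ k))]
    rw [hab, smul_comm]

theorem IsDualizing.projective_dual (hD : IsDualizing R S D) :
    Module.Projective S (X →ₗ[R] D) := by
  obtain ⟨a, b, hab⟩ := hD
  obtain ⟨n, φ, v, h⟩ := exists_dual_basis (X := X) a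
  refine Module.Projective.of_split
    (LinearMap.pi fun k => b.symm.toLinearMap ∘ₗ evalDual R S D X (v k))
    (Fintype.linearCombination S φ) (LinearMap.ext fun ψ => ?_)
  rw [LinearMap.comp_apply, Fintype.linearCombination_apply]
  exact dual_eq_sum hab h ψ

end

end Duality

/-! ### Finitely generated Gorenstein projective modules -/

section FiniteGorensteinProjective

section

variable {R : Type u} [Ring R]

/-- For a finitely generated module `X`, the extension of maps from `X` to arbitrary projective
modules along `X → Y` reduces to maps to the ring, because a map from `X` to a free module has
only finitely many nonzero coordinates. -/
lemma Extends.of_finite {X Y : Type*} [AddCommGroup X] [Module R X] [AddCommGroup Y] [Module R Y]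
    [Module.Finite R X] {i : X →ₗ[R] Y} (hi : Extends i R) (Q : Type*) [AddCommGroup Q]
    [Module R Q] [Module.Projective R Q] : Extends i Q := by
  classical
  intro φ
  obtain ⟨c, hc⟩ := Module.projective_def'.1 (inferInstance : Module.Projective R Q)
  obtain ⟨t, ht⟩ := Module.Finite.fg_top (R := R) (M := X)
  choose ψ hψ using fun q : Q => hi (Finsupp.lapply q ∘ₗ c ∘ₗ φ)
  refine ⟨∑ q ∈ t.biUnion fun x => (c (φ x)).support,
    LinearMap.toSpanSingleton R Q q ∘ₗ ψ q, LinearMap.ext_on ht fun x hx => ?_⟩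
  have h1 (q : Q) : ψ q (i x) = c (φ x) q := LinearMap.congr_fun (hψ q) x
  have h2 : Finsupp.linearCombination R id (c (φ x)) = φ x := LinearMap.congr_fun hc (φ x)
  rw [← h2, Finsupp.linearCombination_apply, Finsupp.sum_of_support_subset (s := t.biUnion
    fun x => (c (φ x)).support) _ (Finset.subset_biUnion_of_mem (fun x => (c (φ x)).support) hx) _
    (by simp), LinearMap.comp_apply, LinearMap.sum_apply]
  exact Finset.sum_congr rfl fun q _ => by simp [h1]

lemma Extends.of_equiv {X Y Q Q' : Type*} [AddCommGroup X] [Module R X] [AddCommGroup Y]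
    [Module R Y] [AddCommGroup Q] [Module R Q] [AddCommGroup Q'] [Module R Q']
    {i : X →ₗ[R] Y} (hi : Extends i Q) (e : Q ≃ₗ[R] Q') : Extends i Q' := by
  intro φ
  obtain ⟨ψ, hψ⟩ := hi (e.symm.toLinearMap ∘ₗ φ)
  refine ⟨e.toLinearMap ∘ₗ ψ, ?_⟩
  rw [LinearMap.comp_assoc, hψ]
  ext x
  simp

end

variable {R S D : Type u} [Ring R] [Ring S] [AddCommGroup D] [Module R D] [Module S D]
  [SMulCommClass R S D] {X : Type u} [AddCommGroup X] [Module R X] [Module.Finite R X]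

lemma IsDualizing.finite_dual [IsNoetherianRing S] (hD : IsDualizing R S D) :
    Module.Finite S (X →ₗ[R] D) := by
  obtain ⟨n, f, hf⟩ := Module.Finite.exists_fin' R X
  have := hD.finite_dual_of_projective (X := Fin n → R)
  exact Module.Finite.of_injective (LinearMap.lcomp S D f) fun φ ψ h => LinearMap.ext fun x => by
    obtain ⟨y, rfl⟩ := hf x
    exact LinearMap.congr_fun h y

/-- A finitely generated Gorenstein projective module embeds into a finitely generated free module,
by a map whose coordinates generate the dual module, with Gorenstein projective cokernel. -/
theorem IsGorensteinProjective.exists_finite_cosyzygy [IsNoetherianRing S]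
    (hD : IsDualizing R S D) (hX : IsGorensteinProjective R X) :
    ∃ (n : ℕ) (C : Type u) (_ : AddCommGroup C) (_ : Module R C) (i : X →ₗ[R] (Fin n → R))
      (p : (Fin n → R) →ₗ[R] C), Module.Finite R C ∧ IsGorensteinProjective R C ∧
        IsShortExact i p ∧ Extends i D := by
  have := hD.finite_dual (X := X)
  obtain ⟨n, g, hg⟩ := Module.Finite.exists_fin' S (X →ₗ[R] D)
  obtain ⟨a, b, hab⟩ := hD
  let i : X →ₗ[R] (Fin n → R) :=
    LinearMap.pi fun k => a.symm.toLinearMap ∘ₗ g (Pi.single k 1)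
  have hiD : Extends i D := by
    intro φ
    obtain ⟨s, rfl⟩ := hg φ
    refine ⟨∑ k, s k • (a.toLinearMap ∘ₗ LinearMap.proj k), LinearMap.ext fun x => ?_⟩
    conv_rhs => rw [pi_eq_sum_univ' s, map_sum]
    simp [i]
  have hiQ (Q : Type u) [AddCommGroup Q] [Module R Q] (hQ : Module.Projective R Q) :
      Extends i Q := (hiD.of_equiv a.symm).of_finite Q
  have hi : Function.Injective i := by
    obtain ⟨P, C, _, _, _, _, j, q, hP, -, h⟩ :=
      isGorensteinClass_isGorensteinProjective.cosyzygy X hX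
    obtain ⟨l, hl⟩ := hiQ P hP j
    have hj := h.inj
    rw [← hl] at hj
    exact Function.Injective.of_comp hj
  exact ⟨n, _, _, _, i, _, inferInstance, hX.cosyzygy (isShortExact_coker hi) hiQ,
    isShortExact_coker hi, hiD⟩

lemma IsGorensteinProjective.exists_finite_syzygy [IsNoetherianRing R]
    (hX : IsGorensteinProjective R X) :
    ∃ (n : ℕ) (K : Type u) (_ : AddCommGroup K) (_ : Module R K) (i : K →ₗ[R] (Fin n → R))
      (p : (Fin n → R) →ₗ[R] X), Module.Finite R K ∧ IsGorensteinProjective R K ∧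
        IsShortExact i p := by
  obtain ⟨n, f, hf⟩ := Module.Finite.exists_fin' R X
  exact ⟨n, _, _, _, _, f, inferInstance, hX.syzygy (isShortExact_ker hf), isShortExact_ker hf⟩

variable [SMulCommClass S R D]

lemma IsGorensteinProjective.evalDual_injective [IsNoetherianRing S]
    (hD : IsDualizing R S D) (hX : IsGorensteinProjective R X) :
    Function.Injective (evalDual R S D X) := by
  obtain ⟨n, C, _, _, i, p, -, -, h, -⟩ := hX.exists_finite_cosyzygy hD
  rw [injective_iff_map_eq_zero]
  refine fun x hx => h.inj (hD.evalDual_bijective_of_projective.1 (LinearMap.ext fun φ => ?_))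
  rw [map_zero, map_zero]
  exact LinearMap.congr_fun hx (φ ∘ₗ i)

/-- Finitely generated Gorenstein projective modules are reflexive. -/
theorem IsGorensteinProjective.evalDual_bijective [IsNoetherianRing S]
    (hD : IsDualizing R S D) (hX : IsGorensteinProjective R X) :
    Function.Bijective (evalDual R S D X) := by
  refine ⟨hX.evalDual_injective hD, fun Φ => ?_⟩
  obtain ⟨n, C, _, _, i, p, _, hC, h, hi⟩ := hX.exists_finite_cosyzygy hD
  obtain ⟨y, hy⟩ := hD.evalDual_bijective_of_projective.2 (Φ ∘ₗ LinearMap.lcomp S D i)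
  have hy (φ : (Fin n → R) →ₗ[R] D) : φ y = Φ (φ ∘ₗ i) := LinearMap.congr_fun hy φ
  -- `p y` is killed by all maps `C → D`, and `C` is torsionless, so `y` comes from `X`
  obtain ⟨x, rfl⟩ := h.exists_of_eq_zero (y := y)
    (hC.evalDual_injective hD <| LinearMap.ext fun ψ => by
    have : (ψ ∘ₗ p) ∘ₗ i = 0 := LinearMap.ext fun x => by simp [h.apply_apply]
    rw [map_zero]
    exact (hy (ψ ∘ₗ p)).trans (by rw [this, map_zero]; rfl))
  refine ⟨x, LinearMap.ext fun φ => ?_⟩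
  obtain ⟨ψ, rfl⟩ := hi φ
  exact hy ψ

/-- The dual of a finitely generated Gorenstein projective module is Gorenstein projective. -/
theorem IsGorensteinProjective.dual [IsNoetherianRing R] [IsNoetherianRing S]
    (hD : IsDualizing R S D) (hX : IsGorensteinProjective R X) :
    IsGorensteinProjective S (X →ₗ[R] D) := by
  have hDp : Module.Projective R D := by
    obtain ⟨a, -⟩ := hD
    exact Module.Projective.of_equiv a
  refine IsGorensteinClass.isGorensteinProjective
    (𝒞 := fun Y _ _ => ∃ (X : Type u) (_ : AddCommGroup X) (_ : Module R X),
      Module.Finite R X ∧ IsGorensteinProjective R X ∧ Nonempty (Y ≃ₗ[S] (X →ₗ[R] D)))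
    ⟨?_, ?_, ?_⟩ ⟨X, _, _, inferInstance, hX, ⟨LinearEquiv.refl S _⟩⟩
  · rintro Y _ _ ⟨X, _, _, _, hX, ⟨e⟩⟩
    obtain ⟨n, C, _, _, i, p, _, hC, h, hi⟩ := hX.exists_finite_cosyzygy hD
    exact ⟨_, _, _, _, _, _, _, _, hD.projective_dual (X := Fin n → R),
      ⟨C, _, _, inferInstance, hC, ⟨LinearEquiv.refl S _⟩⟩, (h.dual hi).comp_equiv e.symm⟩
  · rintro Y _ _ ⟨X, _, _, _, hX, ⟨e⟩⟩
    obtain ⟨n, K, _, _, i, p, _, hK, h⟩ := hX.exists_finite_syzygy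
    exact ⟨_, _, _, _, _, _, _, _, hD.projective_dual (X := Fin n → R),
      ⟨K, _, _, inferInstance, hK, ⟨LinearEquiv.refl S _⟩⟩,
      (h.dual (hX.extVanishes D _ _ _ _ h)).equiv_comp e⟩
  · rintro Y Q _ _ _ _ ⟨X, _, _, _, hX, ⟨e⟩⟩ hQ
    obtain ⟨n, C, _, _, i, p, _, hC, h, hi⟩ := hX.exists_finite_cosyzygy hD
    have := hD.projective_dual (X := Fin n → R)
    have := hD.finite_dual (X := C)
    have hp : Extends (LinearMap.lcomp S D p) D := by
      -- By reflexivity of `C`, a map `C^* → D` is the evaluation at some element of `C`, which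
      -- lifts along `p`.
      intro Φ
      obtain ⟨c, rfl⟩ := (hC.evalDual_bijective hD).2 Φ
      obtain ⟨y, rfl⟩ := h.surj c
      exact ⟨evalDual R S D _ y, rfl⟩
    obtain ⟨-, b, -⟩ := id hD
    exact ((h.dual hi).extVanishes ((hp.of_equiv b.symm).of_finite Q)).of_equiv e

end FiniteGorensteinProjective

/-! ### Transposes and Gorenstein transposes -/

section Transpose

variable {R : Type u} [Ring R]

/-- Given `g : X₁ → X₀`, let `Y = P₀ ×_{X₀} X₁` for an epimorphism `P₀ → X₀` with kernel `N`. Then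
`Coker (P₀^* → Y^*) ≅ Coker g^*`. -/
lemma nonempty_cokerStar_fiberProduct {X₁ X₀ P₀ N : Type u} [AddCommGroup X₁] [Module R X₁]
    [AddCommGroup X₀] [Module R X₀] [AddCommGroup P₀] [Module R P₀] [AddCommGroup N] [Module R N]
    (g : X₁ →ₗ[R] X₀) {j : N →ₗ[R] P₀} {q : P₀ →ₗ[R] X₀} (h : IsShortExact j q)
    (hj : Extends j R) :
    Nonempty (CokerStar R g ≃ₗ[Rᵐᵒᵖ] CokerStar R (LinearMap.fst R P₀ X₁ ∘ₗ
      (LinearMap.ker (q.coprod (-g))).subtype)) := by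
  set Y := LinearMap.ker (q.coprod (-g)) with hY
  let s : Y →ₗ[R] X₁ := LinearMap.snd R P₀ X₁ ∘ₗ Y.subtype
  let t : Y →ₗ[R] P₀ := LinearMap.fst R P₀ X₁ ∘ₗ Y.subtype
  have hmem (a x) : (a, x) ∈ Y ↔ q a = g x := by
    simp [hY, ← sub_eq_add_neg, sub_eq_zero]
  have hst : q ∘ₗ t = g ∘ₗ s := LinearMap.ext fun y => (hmem _ _).1 y.2
  have hs : Function.Surjective s := fun x => by
    obtain ⟨a, ha⟩ := h.surj (g x)
    exact ⟨⟨(a, x), (hmem _ _).2 ha⟩, rfl⟩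
  let c : (X₁ →ₗ[R] R) →ₗ[Rᵐᵒᵖ] CokerStar R t :=
    (LinearMap.range (starMap R t)).mkQ ∘ₗ starMap R s
  have hker : LinearMap.range (starMap R g) = LinearMap.ker c := by
    ext ψ
    constructor
    · rintro ⟨φ, rfl⟩
      refine (Submodule.Quotient.mk_eq_zero _).2 ⟨φ ∘ₗ q, ?_⟩
      change φ ∘ₗ (q ∘ₗ t) = _
      rw [hst]
      rfl
    · intro hψ
      obtain ⟨φ, hφ⟩ := (Submodule.Quotient.mk_eq_zero _).1 hψ
      obtain ⟨θ, hθ⟩ := exists_comp_eq_of_surjective h.surj φ (by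
        intro a ha
        exact (LinearMap.congr_fun hφ ⟨(a, 0), (hmem _ _).2 (by simp [ha])⟩).trans (map_zero ψ))
      refine ⟨θ, LinearMap.ext fun x => ?_⟩
      obtain ⟨y, rfl⟩ := hs x
      change θ ((g ∘ₗ s) y) = _
      rw [← hst]
      exact (hθ _).trans (LinearMap.congr_fun hφ y)
  have hc : Function.Surjective c := by
    intro z
    obtain ⟨ψ, rfl⟩ := Submodule.mkQ_surjective _ z
    -- the restriction of `ψ` to `N` extends to `P₀`
    obtain ⟨φ, hφ⟩ := hj (ψ ∘ₗ (LinearMap.inl R P₀ X₁ ∘ₗ j).codRestrict Y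
      fun n => (hmem _ _).2 (by simp [h.apply_apply]))
    obtain ⟨θ, hθ⟩ := exists_comp_eq_of_surjective hs (ψ - starMap R t φ) (by
      rintro ⟨⟨a, x⟩, hax⟩ hy
      obtain rfl : x = 0 := hy
      obtain ⟨n, rfl⟩ := h.exists_of_eq_zero (y := a) (by simpa using (hmem _ _).1 hax)
      exact sub_eq_zero.2 (LinearMap.congr_fun hφ n).symm)
    refine ⟨θ, (Submodule.Quotient.eq _).2 ⟨-φ, ?_⟩⟩
    rw [map_neg, eq_sub_iff_add_eq, neg_add_eq_sub]
    exact (LinearMap.ext hθ).symm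
  exact ⟨(Submodule.quotEquivOfEq _ _ hker).trans (c.quotKerEquivOfSurjective hc)⟩

/-- For an exact sequence `0 → L → P → Y → 0` whose dual is exact, and `t : Y → P₀`, the sequence
`0 → Coker t^* → Coker (P → Y → P₀)^* → L^* → 0` is exact. -/
lemma exists_isShortExact_cokerStar_comp {L P Y P₀ : Type u} [AddCommGroup L] [Module R L]
    [AddCommGroup P] [Module R P] [AddCommGroup Y] [Module R Y] [AddCommGroup P₀] [Module R P₀]
    {l : L →ₗ[R] P} {r : P →ₗ[R] Y} (h : IsShortExact l r) (hl : Extends l R) (t : Y →ₗ[R] P₀) :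
    ∃ (i : CokerStar R t →ₗ[Rᵐᵒᵖ] CokerStar R (t ∘ₗ r))
      (p : CokerStar R (t ∘ₗ r) →ₗ[Rᵐᵒᵖ] (L →ₗ[R] R)), IsShortExact i p := by
  have hd : IsShortExact (starMap R r) (starMap R l) := h.dual hl
  refine ⟨(LinearMap.range (starMap R t)).mapQ _ (starMap R r) ?_,
    (LinearMap.range (starMap R (t ∘ₗ r))).liftQ (starMap R l) ?_, ?_, ?_, ?_⟩
  · rintro _ ⟨φ, rfl⟩
    exact ⟨φ, rfl⟩
  · rintro _ ⟨φ, rfl⟩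
    exact hd.apply_apply (starMap R t φ)
  · rw [injective_iff_map_eq_zero]
    intro z hz
    obtain ⟨ψ, rfl⟩ := Submodule.mkQ_surjective _ z
    obtain ⟨φ, hφ⟩ := (Submodule.Quotient.mk_eq_zero _).1 hz
    exact (Submodule.Quotient.mk_eq_zero _).2 ⟨φ, hd.inj hφ⟩
  · intro z
    obtain ⟨ψ, rfl⟩ := Submodule.mkQ_surjective _ z
    constructor
    · intro hψ
      obtain ⟨θ, rfl⟩ := hd.exists_of_eq_zero hψ
      exact ⟨(LinearMap.range (starMap R t)).mkQ θ, rfl⟩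
    · rintro ⟨y, hy⟩
      obtain ⟨θ, rfl⟩ := Submodule.mkQ_surjective _ y
      rw [← hy]
      exact hd.apply_apply θ
  · intro φ
    obtain ⟨ψ, rfl⟩ := hd.surj φ
    exact ⟨(LinearMap.range (starMap R (t ∘ₗ r))).mkQ ψ, rfl⟩

variable [IsNoetherianRing R] [IsNoetherianRing Rᵐᵒᵖ]

/-- A Gorenstein transpose embeds into a transpose with finitely generated Gorenstein projective
cokernel. -/
theorem IsGorensteinTranspose.exists_isTranspose {A : Type v} [AddCommGroup A] [Module R A]
    {M : Type w} [AddCommGroup M] [Module Rᵐᵒᵖ M] (hM : IsGorensteinTranspose R A M) :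
    ∃ (T H : Type u) (_ : AddCommGroup T) (_ : Module Rᵐᵒᵖ T)
      (_ : AddCommGroup H) (_ : Module Rᵐᵒᵖ H)
      (i : M →ₗ[Rᵐᵒᵖ] T) (q : T →ₗ[Rᵐᵒᵖ] H),
      IsTranspose R A T ∧ Module.Finite Rᵐᵒᵖ H ∧ IsGorensteinProjective Rᵐᵒᵖ H ∧
        IsShortExact i q := by
  obtain ⟨X₁, X₀, _, _, _, _, g, p, _, _, hX₁, hX₀, hgp, hp, ⟨e⟩⟩ := hM
  have hD := isDualizing_mulOpposite R
  obtain ⟨n, N, _, _, j, q, _, hN, hq⟩ := hX₀.exists_finite_syzygy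
  have hj : Extends j R := hX₀.extVanishes R _ _ _ _ hq
  obtain ⟨e'⟩ := nonempty_cokerStar_fiberProduct g hq hj
  set Y := LinearMap.ker (q.coprod (-g)) with hY
  let t : Y →ₗ[R] (Fin n → R) := LinearMap.fst R (Fin n → R) X₁ ∘ₗ Y.subtype
  have hmem (a x) : (a, x) ∈ Y ↔ q a = g x := by
    simp [hY, ← sub_eq_add_neg, sub_eq_zero]
  -- `Y` is an extension of `X₁` by `N`
  have hNY : IsShortExact ((LinearMap.inl R (Fin n → R) X₁ ∘ₗ j).codRestrict Y
      fun k => (hmem _ _).2 (by simp [hq.apply_apply]))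
      (LinearMap.snd R (Fin n → R) X₁ ∘ₗ Y.subtype) := by
    refine ⟨fun x y hxy => hq.inj (congrArg (fun z => z.1.1) hxy), fun y => ⟨fun hy => ?_, ?_⟩,
      fun x => ?_⟩
    · obtain ⟨⟨a, x⟩, hax⟩ := y
      obtain rfl : x = 0 := hy
      obtain ⟨k, rfl⟩ := hq.exists_of_eq_zero (y := a) (by simpa using (hmem _ _).1 hax)
      exact ⟨k, rfl⟩
    · rintro ⟨k, rfl⟩
      rfl
    · obtain ⟨a, ha⟩ := hq.surj (g x)
      exact ⟨⟨(a, x), (hmem _ _).2 ha⟩, rfl⟩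
  have hYG : IsGorensteinProjective R Y := hNY.isGorensteinProjective hN hX₁
  obtain ⟨m, L, _, _, l, r, _, hL, hr⟩ := hYG.exists_finite_syzygy
  obtain ⟨a, b, hab⟩ := exists_isShortExact_cokerStar_comp hr (hYG.extVanishes R _ _ _ _ hr) t
  refine ⟨CokerStar R (t ∘ₗ r), L →ₗ[R] R, _, _, _, _, a ∘ₗ (e.trans e').toLinearMap, b,
    ⟨Fin m → R, Fin n → R, _, _, _, _, t ∘ₗ r, p ∘ₗ q, inferInstance, inferInstance, inferInstance,
      inferInstance, fun y => ?_, hp.comp hq.surj, ⟨LinearEquiv.refl _ _⟩⟩,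
    hD.finite_dual, hL.dual hD, hab.equiv_comp _⟩
  rw [LinearMap.comp_apply, hgp (q y)]
  constructor
  · rintro ⟨x, hx⟩
    obtain ⟨z, hz⟩ := hr.surj ⟨(y, x), (hmem _ _).2 hx.symm⟩
    exact ⟨z, by simp [hz, t]⟩
  · rintro ⟨z, rfl⟩
    exact ⟨(r z).1.2, ((hmem _ _).1 (r z).2).symm⟩

/-- A module that embeds into a transpose with finitely generated Gorenstein projective cokernel is
a Gorenstein transpose. -/
theorem IsTranspose.isGorensteinTranspose {A : Type v} [AddCommGroup A] [Module R A]
    {M : Type w} [AddCommGroup M] [Module Rᵐᵒᵖ M] {T H : Type u} [AddCommGroup T] [Module Rᵐᵒᵖ T]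
    [AddCommGroup H] [Module Rᵐᵒᵖ H] [Module.Finite Rᵐᵒᵖ H] {i : M →ₗ[Rᵐᵒᵖ] T} {q : T →ₗ[Rᵐᵒᵖ] H}
    (hT : IsTranspose R A T) (hH : IsGorensteinProjective Rᵐᵒᵖ H) (h : IsShortExact i q) :
    IsGorensteinTranspose R A M := by
  obtain ⟨P₁, P₀, _, _, _, _, f, p, _, _, _, _, hfp, hp, ⟨e⟩⟩ := hT
  have hD := isDualizing_mulOpposite R
  have := hD.finite_dual (X := P₁)
  have := hD.projective_dual (X := P₁)
  -- the projection of `P₁^*` onto `T`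
  let π : (P₁ →ₗ[R] R) →ₗ[Rᵐᵒᵖ] T := e.symm.toLinearMap ∘ₗ (LinearMap.range (starMap R f)).mkQ
  have hπ : Function.Surjective π := e.symm.surjective.comp (Submodule.mkQ_surjective _)
  have hπ0 (φ) : π φ = 0 ↔ φ ∈ LinearMap.range (starMap R f) := by
    simp [π]
  have hK := isShortExact_ker (p := q ∘ₗ π) (h.surj.comp hπ)
  set K := LinearMap.ker (q ∘ₗ π)
  have hKG : IsGorensteinProjective Rᵐᵒᵖ K := hH.syzygy hK
  have : Module.Projective Rᵐᵒᵖ R := by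
    obtain ⟨-, b, -⟩ := hD
    exact Module.Projective.of_equiv b
  have hKR : Extends (R := Rᵐᵒᵖ) (X := K) K.subtype R := hH.extVanishes R K _ _ (q ∘ₗ π) hK
  let ε : P₀ ≃ₗ[R] ((P₀ →ₗ[R] R) →ₗ[Rᵐᵒᵖ] R) :=
    LinearEquiv.ofBijective (evalDual R Rᵐᵒᵖ R P₀) hD.evalDual_bijective_of_projective
  -- the corestriction of `f^*` to `K`, and its transpose `g : K^* → P₀`
  let c : (P₀ →ₗ[R] R) →ₗ[Rᵐᵒᵖ] K := (starMap R f).codRestrict K fun φ => by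
    rw [LinearMap.mem_ker, LinearMap.comp_apply, (hπ0 _).2 ⟨φ, rfl⟩, map_zero]
  let g : (K →ₗ[Rᵐᵒᵖ] R) →ₗ[R] P₀ := ε.symm.toLinearMap ∘ₗ LinearMap.lcomp R R c
  have hg (κ : K →ₗ[Rᵐᵒᵖ] R) (φ : P₀ →ₗ[R] R) : φ (g κ) = κ (c φ) :=
    LinearMap.congr_fun (ε.apply_symm_apply (LinearMap.lcomp R R c κ)) φ
  have hgf (x : P₁) : g (evalDual R Rᵐᵒᵖ R P₁ x ∘ₗ K.subtype) = f x :=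
    ε.injective (LinearMap.ext fun φ => hg _ φ)
  have hrange (y : P₀) : y ∈ Set.range g ↔ y ∈ Set.range f := by
    constructor
    · rintro ⟨κ, rfl⟩
      obtain ⟨Φ, rfl⟩ := hKR κ
      obtain ⟨x, rfl⟩ := (hD.evalDual_bijective_of_projective (X := P₁)).2 Φ
      exact ⟨x, (hgf x).symm⟩
    · rintro ⟨x, rfl⟩
      exact ⟨_, hgf x⟩
  -- Both `M` and `Coker g^*` are quotients of `K` by the image of `c`.
  let μ : K →ₗ[Rᵐᵒᵖ] M := (LinearEquiv.ofInjective i h.inj).symm.toLinearMap ∘ₗ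
    (π ∘ₗ K.subtype).codRestrict (LinearMap.range i) (fun k => h.exists_of_eq_zero k.2)
  have hμ (k) : i (μ k) = π k :=
    congrArg Subtype.val ((LinearEquiv.ofInjective i h.inj).apply_symm_apply
      ((π ∘ₗ K.subtype).codRestrict (LinearMap.range i) (fun k => h.exists_of_eq_zero k.2) k))
  have hμs : Function.Surjective μ := by
    intro m
    obtain ⟨φ, hφ⟩ := hπ (i m)
    refine ⟨⟨φ, ?_⟩, h.inj ?_⟩
    · rw [LinearMap.mem_ker, LinearMap.comp_apply, hφ, h.apply_apply]
    · rw [hμ, hφ]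
  have hevK := hKG.evalDual_bijective hD.symm
  let ν : K →ₗ[Rᵐᵒᵖ] CokerStar R g :=
    (LinearMap.range (starMap R g)).mkQ ∘ₗ evalDual Rᵐᵒᵖ R R K
  have hνs : Function.Surjective ν := (Submodule.mkQ_surjective _).comp hevK.2
  have hgc (φ : P₀ →ₗ[R] R) : starMap R g φ = evalDual Rᵐᵒᵖ R R K (c φ) :=
    LinearMap.ext fun κ => hg κ φ
  have hker : LinearMap.ker μ = LinearMap.ker ν := by
    ext k
    have h1 : k ∈ LinearMap.ker μ ↔ ∃ φ, c φ = k := by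
      rw [LinearMap.mem_ker, ← map_eq_zero_iff i h.inj, hμ, hπ0]
      exact exists_congr fun φ => (Subtype.ext_iff (a1 := c φ) (a2 := k)).symm
    have h2 : k ∈ LinearMap.ker ν ↔ ∃ φ, c φ = k := by
      rw [LinearMap.mem_ker, LinearMap.comp_apply, Submodule.mkQ_apply,
        Submodule.Quotient.mk_eq_zero]
      exact exists_congr fun φ => by rw [hgc, hevK.1.eq_iff]
    rw [h1, h2]
  exact ⟨K →ₗ[Rᵐᵒᵖ] R, P₀, _, _, _, _, g, p, hD.symm.finite_dual (X := K), inferInstance,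
    hKG.dual hD.symm, .of_projective, fun y => (hfp y).trans (hrange y).symm, hp,
    ⟨(LinearMap.quotKerEquivOfSurjective μ hμs).symm.trans
      ((Submodule.quotEquivOfEq _ _ hker).trans
        (LinearMap.quotKerEquivOfSurjective (M := K) (M₂ := CokerStar R g) ν hνs))⟩⟩

end Transpose

theorem theorem3p1 (R : Type u) [Ring R] [IsNoetherianRing R] [IsNoetherianRing Rᵐᵒᵖ]
    (A : Type v) [AddCommGroup A] [Module R A] [Module.Finite R A]
    (M : Type w) [AddCommGroup M] [Module Rᵐᵒᵖ M] [Module.Finite Rᵐᵒᵖ M] :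
    IsGorensteinTranspose R A M ↔
      ∃ (T H : Type u) (_ : AddCommGroup T) (_ : Module Rᵐᵒᵖ T)
        (_ : AddCommGroup H) (_ : Module Rᵐᵒᵖ H)
        (i : M →ₗ[Rᵐᵒᵖ] T) (q : T →ₗ[Rᵐᵒᵖ] H),
        IsTranspose R A T ∧
        Module.Finite Rᵐᵒᵖ H ∧ IsGorensteinProjective Rᵐᵒᵖ H ∧
        Function.Injective i ∧ Function.Exact i q ∧ Function.Surjective q := by
  constructor
  · intro hM
    obtain ⟨T, H, _, _, _, _, i, q, hT, hH, hG, h⟩ := hM.exists_isTranspose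
    exact ⟨T, H, _, _, _, _, i, q, hT, hH, hG, h.inj, h.exact, h.surj⟩
  · rintro ⟨T, H, _, _, _, _, i, q, hT, _, hG, h1, h2, h3⟩
    exact hT.isGorensteinTranspose hG ⟨h1, h2, h3⟩
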